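/- Let $\mathcal A$ be a unital $C^*$-algebra and let $E$ be a $C^*$-correspondence over $\mathcal A$, that is, a right Hilbert $C^*$-module over $\mathcal A$ with a left action of $\mathcal A$ given by a $*$-homomorphism from $\mathcal A$ into the adjointable operators on $E$. A representation $(S,\sigma)$ of $E$ on a Hilbert space $\mathcal H$ consists of a completely contractive linear map $S:E\to\mathcal B(\mathcal H)$ and a unital $*$-representation $\sigma:\mathcal A\to\mathcal B(\mathcal H)$ with $S(a\xi b)=\sigma(a)S(\xi)\sigma(b)$ for $a,b\in\mathcal A$ and $\xi\in E$. It is *isometric* if $S(\xi)^*S(\eta)=\sigma(\langle\xi,\eta\rangle)$ for all $\xi,\eta\in E$, and *fully coisometric* if the operator $\tilde S:E\otimes_\sigma\mathcal H\to\mathcal H$, $\tilde S(\xi\otimes h)=S(\xi)h$, is a coisometry. Here $E\otimes_\sigma\mathcal H$ is the Hausdorff completion of the algebraic tensor product for $\langle\xi\otimes h,\eta\otimes k\rangle=\langle h,\sigma(\langle\xi,\eta\rangle)k\rangle$. An isometric representation $(S,\sigma)$ on $\mathcal H$ is *finitely correlated* if there are a non-zero finite dimensional subspace $\mathcal V\subseteq\mathcal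 H$ and a representation $(A,\rho)$ of $E$ on $\mathcal V$ whose minimal isometric dilation is $(S,\sigma)$; that is, $\mathcal V$ reduces $\sigma$ with $\sigma(\cdot)|_{\mathcal V}=\rho$, $\mathcal V^\perp$ is invariant under every $S(\xi)$, $P_{\mathcal V}S(\xi)|_{\mathcal V}=A(\xi)$ for all $\xi\in E$, and $\mathcal H$ is the closed linear span of the vectors $S(\xi_1)\cdots S(\xi_n)v$ with $n\ge 0$, $\xi_i\in E$, $v\in\mathcal V$. Let $\mathfrak S$ be the unital algebra closed in the weak operator topology that is generated by the operators $S(\xi)$ and $\sigma(a)$. A closed subspace $\mathcal V\subseteq\mathcal H$ is *coinvariant* if it is invariant under $X^*$ for every $X\in\mathfrak S$, and *cyclic* if the vectors $Xv$ with $X\in\mathfrak S$, $v\in\mathcal V$ have closed linear span $\mathcal H$. It is a *minimal cyclic coinvariant subspace* for $(S,\sigma)$ if it is cyclic and coinvariant and no proper closed subspace of it is both cyclic and coinvariant. Two representations of $E$ are *unitarily equivalent* if there is a unitary between their Hilbert spaces that intertwines both the maps on $E$ and the representations of $\mathcal A$. Suppose $(S,\sigma)$ and $(T,\tau)$ are finitely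 correlated, isometric, fully coisometric representations of $E$ on Hilbert spaces $\mathcal H_S$ and $\mathcal H_T$ respectively. Then each of them has a unique minimal cyclic coinvariant subspace, $\mathcal V_S\subseteq\mathcal H_S$ and $\mathcal V_T\subseteq\mathcal H_T$ respectively; these subspaces are finite dimensional; and $(S,\sigma)$ and $(T,\tau)$ are unitarily equivalent if and only if the finite dimensional representations $(P_{\mathcal V_S}S(\cdot)|_{\mathcal V_S},\sigma(\cdot)|_{\mathcal V_S})$ and $(P_{\mathcal V_T}T(\cdot)|_{\mathcal V_T},\tau(\cdot)|_{\mathcal V_T})$ are unitarily equivalent. -/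

import Mathlib

open scoped TensorProduct InnerProductSpace

noncomputable section

/-! ### Hilbert C*-modules and C*-correspondences -/

/-- A C*-correspondence `E` over the unital C*-algebra `A`: a (right) Hilbert C*-module over `A`
with a left action of `A` given by a *-homomorphism `φ` from `A` to the adjointable operators.

Mathlib's `CStarModule B E` has `⟪x, b • y⟫ = b * ⟪x, y⟫`, so a right Hilbert `A`-module in the
usual sense, with `⟪x, y a⟫ = ⟪x, y⟫ a`, is a `CStarModule Aᵐᵒᵖ E`; here `y a` is
`MulOpposite.op a • y`, and the `A`-valued inner product is `CStarCorrespondence.ip A x y` below.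
Since `⟪φ(a) x, y⟫ = ⟪x, φ(a*) y⟫`, each `φ(a)` is adjointable with adjoint `φ(a*)`. -/
class CStarCorrespondence (A E : Type*) [CStarAlgebra A] [PartialOrder A] [StarOrderedRing A]
    [NormedAddCommGroup E] [NormedSpace ℂ E] [CompleteSpace E] [Module Aᵐᵒᵖ E]
    extends CStarModule Aᵐᵒᵖ E where
  /-- The left action `φ`. -/
  leftAction : A →ₙₐ[ℂ] (E →L[ℂ] E)
  inner_leftAction : ∀ (a : A) (x y : E),
    inner (leftAction a x) y = inner x (leftAction (star a) y)

namespace CStarCorrespondence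

variable (A : Type*) {E : Type*} [CStarAlgebra A] [PartialOrder A] [StarOrderedRing A]
  [NormedAddCommGroup E] [NormedSpace ℂ E] [CompleteSpace E] [Module Aᵐᵒᵖ E]
  [CStarCorrespondence A E]

/-- The `A`-valued inner product, conjugate linear in the first variable. -/
def ip (x y : E) : A := (inner Aᵐᵒᵖ x y).unop

lemma ip_add_right (x y z : E) : ip A x (y + z) = ip A x y + ip A x z := by
  simp [ip]

lemma ip_add_left (x y z : E) : ip A (x + y) z = ip A x z + ip A y z := by
  simp [ip]

lemma ip_smul_right (c : ℂ) (x y : E) : ip A x (c • y) = c • ip A x y := by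
  simp [ip]

lemma ip_smul_left (c : ℂ) (x y : E) : ip A (c • x) y = star c • ip A x y := by
  simp [ip]

lemma star_ip (x y : E) : star (ip A x y) = ip A y x := by
  rw [ip, ip, ← CStarModule.star_inner x y]; rfl

lemma ip_op_smul_right (x y : E) (a : A) :
    ip A x (MulOpposite.op a • y) = ip A x y * a := by
  simp [ip]

lemma ip_op_smul_left (x y : E) (a : A) :
    ip A (MulOpposite.op a • x) y = star a * ip A x y := by
  simp [ip]

lemma ip_self_nonneg (x : E) : 0 ≤ ip A x x :=
  (CStarModule.inner_self_nonneg : 0 ≤ inner Aᵐᵒᵖ x x)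

lemma ip_sum_right {ι : Type*} (s : Finset ι) (x : E) (y : ι → E) :
    ip A x (∑ i ∈ s, y i) = ∑ i ∈ s, ip A x (y i) := by
  simp [ip]

lemma ip_sum_left {ι : Type*} (s : Finset ι) (x : ι → E) (y : E) :
    ip A (∑ i ∈ s, x i) y = ∑ i ∈ s, ip A (x i) y := by
  simp [ip]

end CStarCorrespondence

open CStarCorrespondence

/-! ### The Hilbert space `E ⊗_σ H` -/

section Positivity

variable {A : Type*} [CStarAlgebra A] [PartialOrder A] [StarOrderedRing A]

lemma exists_posPart_negPart {B : Type*} [CStarAlgebra B] [PartialOrder B] [StarOrderedRing B]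
    (M : B) (hM : IsSelfAdjoint M) :
    ∃ P C : B, 0 ≤ P ∧ 0 ≤ C ∧ M = P - C ∧ P * C = 0 :=
  ⟨M⁺, M⁻, CFC.posPart_nonneg M, CFC.negPart_nonneg M, (CFC.posPart_sub_negPart M hM).symm,
    CFC.posPart_mul_negPart M⟩

lemma exists_eq_star_mul_self {B : Type*} [CStarAlgebra B] [PartialOrder B] [StarOrderedRing B]
    {M : B} (hM : 0 ≤ M) : ∃ C : B, M = star C * C :=
  CStarAlgebra.nonneg_iff_eq_star_mul_self.mp hM

/-- A self-adjoint matrix over a C*-algebra is positive if its quadratic form is. -/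
lemma cstarMatrix_nonneg {n : ℕ} (M : CStarMatrix (Fin n) (Fin n) A) (hM : IsSelfAdjoint M)
    (h : ∀ a : Fin n → A, 0 ≤ ∑ i, ∑ j, star (a i) * M i j * a j) : 0 ≤ M := by
  obtain ⟨P, C, hP0, hC0, hdec, hPC⟩ := exists_posPart_negPart M hM
  have hCs : star C = C := (IsSelfAdjoint.of_nonneg hC0).star_eq
  obtain ⟨B, hB⟩ := exists_eq_star_mul_self hC0
  have hY : star (B * C) * (B * C) = C * C * C := by
    rw [star_mul, hCs]
    calc C * star B * (B * C) = C * (star B * B) * C := by simp only [mul_assoc]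
      _ = C * C * C := by rw [← hB]
  have hCMC : star C * M * C = -(C * C * C) := by
    rw [hCs, hdec, mul_sub, sub_mul, mul_assoc C P C, hPC]
    simp
  have hD : B * C = 0 := by
    ext k j
    have h1 : 0 ≤ (star C * M * C) j j := by
      have := h (fun i => C i j)
      convert this using 1
      simp only [CStarMatrix.mul_apply, CStarMatrix.star_apply, Finset.sum_mul]
      rw [Finset.sum_comm]
    rw [hCMC, ← hY] at h1
    have h2 : (star (B * C) * (B * C)) j j = ∑ k, star ((B * C) k j) * (B * C) k j := by
      rw [CStarMatrix.mul_apply]; simp only [CStarMatrix.star_apply]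
    rw [CStarMatrix.neg_apply, h2, neg_nonneg] at h1
    have h3 : ∑ k, star ((B * C) k j) * (B * C) k j = 0 :=
      le_antisymm h1 (Finset.sum_nonneg fun k _ => star_mul_self_nonneg _)
    have h4 := (Finset.sum_eq_zero_iff_of_nonneg
      (fun k _ => star_mul_self_nonneg ((B * C) k j))).mp h3 k (Finset.mem_univ k)
    simpa using h4
  have h3 : C * C * C = 0 := by rw [← hY, hD]; simp
  have h4 : C * C = 0 := by
    rw [← CStarRing.star_mul_self_eq_zero_iff, star_mul, hCs, ← mul_assoc, h3, zero_mul]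
  have h5 : C = 0 := by
    rw [← CStarRing.star_mul_self_eq_zero_iff, hCs, h4]
  rw [hdec, h5, sub_zero]
  exact hP0

variable {E : Type*} [NormedAddCommGroup E] [NormedSpace ℂ E] [CompleteSpace E]
  [Module Aᵐᵒᵖ E] [CStarCorrespondence A E]

variable (A) in
/-- The Gram matrix of a finite family in a Hilbert C*-module is positive. -/
lemma gram_nonneg {n : ℕ} (x : Fin n → E) :
    0 ≤ (CStarMatrix.ofMatrix fun i j => ip A (x i) (x j) : CStarMatrix (Fin n) (Fin n) A) := by
  apply cstarMatrix_nonneg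
  · ext i j
    exact star_ip A (x j) (x i)
  · intro a
    have := ip_self_nonneg A (∑ i, MulOpposite.op (a i) • x i)
    rw [ip_sum_left] at this
    simp only [ip_sum_right, ip_op_smul_left, ip_op_smul_right] at this
    exact this

variable {H : Type*} [NormedAddCommGroup H] [InnerProductSpace ℂ H] [CompleteSpace H]

lemma gram_inner_nonneg (σ : A →⋆ₐ[ℂ] (H →L[ℂ] H)) {n : ℕ} (x : Fin n → E) (h : Fin n → H) :
    0 ≤ RCLike.re (∑ i, ∑ j, ⟪h i, σ (ip A (x i) (x j)) (h j)⟫_ℂ) := by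
  obtain ⟨B, hB⟩ := exists_eq_star_mul_self (gram_nonneg A x)
  have hij : ∀ i j, ip A (x i) (x j) = ∑ k, star (B k i) * B k j := by
    intro i j
    have := congrArg (fun M : CStarMatrix (Fin n) (Fin n) A => M i j) hB
    simp only [CStarMatrix.mul_apply, CStarMatrix.star_apply] at this
    exact this
  have key : ∑ i, ∑ j, ⟪h i, σ (ip A (x i) (x j)) (h j)⟫_ℂ
      = ∑ k, ⟪∑ i, σ (B k i) (h i), ∑ j, σ (B k j) (h j)⟫_ℂ := by
    simp only [hij, map_sum, map_mul, map_star, sum_apply,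
      mul_apply_eq_comp, inner_sum, sum_inner,
      ContinuousLinearMap.star_eq_adjoint, ContinuousLinearMap.adjoint_inner_right]
    rw [Finset.sum_comm]
    rw [Finset.sum_comm_cycle]
  rw [key, map_sum]
  exact Finset.sum_nonneg fun k _ => inner_self_nonneg

end Positivity

section Tensor

variable {A : Type*} (E : Type*) {H : Type*} [CStarAlgebra A] [PartialOrder A] [StarOrderedRing A]
  [NormedAddCommGroup E] [NormedSpace ℂ E] [CompleteSpace E] [Module Aᵐᵒᵖ E]
  [CStarCorrespondence A E]
  [NormedAddCommGroup H] [InnerProductSpace ℂ H] [CompleteSpace H]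

/-- The sesquilinear form on the algebraic tensor product `E ⊗ H` determined by
`⟨ξ ⊗ h, η ⊗ k⟩ = ⟨h, σ(⟨ξ, η⟩) k⟩`. -/
def tensorForm (σ : A →⋆ₐ[ℂ] (H →L[ℂ] H)) : E ⊗[ℂ] H →ₗ⋆[ℂ] E ⊗[ℂ] H →ₗ[ℂ] ℂ :=
  TensorProduct.lift <| LinearMap.mk₂'ₛₗ (starRingEnd ℂ) (starRingEnd ℂ)
    (fun (ξ : E) (h : H) => TensorProduct.lift <| LinearMap.mk₂ ℂ
      (fun (η : E) (k : H) => ⟪h, σ (ip A ξ η) k⟫_ℂ)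
      (fun η₁ η₂ k => by simp [ip_add_right])
      (fun c η k => by simp [ip_smul_right])
      (fun η k₁ k₂ => by simp)
      (fun c η k => by simp))
    (fun ξ₁ ξ₂ h => by ext η k; simp [ip_add_left])
    (fun c ξ h => by ext η k; simp [ip_smul_left])
    (fun ξ h₁ h₂ => by ext η k; simp)
    (fun c ξ h => by ext η k; simp [mul_comm])

lemma tensorForm_tmul (σ : A →⋆ₐ[ℂ] (H →L[ℂ] H)) (ξ η : E) (h k : H) :
    tensorForm E σ (ξ ⊗ₜ h) (η ⊗ₜ k) = ⟪h, σ (ip A ξ η) k⟫_ℂ := rfl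

lemma tensorForm_conj_symm (σ : A →⋆ₐ[ℂ] (H →L[ℂ] H)) (x y : E ⊗[ℂ] H) :
    starRingEnd ℂ (tensorForm E σ y x) = tensorForm E σ x y := by
  induction x using TensorProduct.induction_on with
  | zero => simp
  | add x₁ x₂ h₁ h₂ => simp [h₁, h₂]
  | tmul ξ h =>
    induction y using TensorProduct.induction_on with
    | zero => simp
    | add y₁ y₂ h₁ h₂ => simp [h₁, h₂]
    | tmul η k =>
      rw [tensorForm_tmul, tensorForm_tmul, inner_conj_symm, ← star_ip A ξ η, map_star,
        ContinuousLinearMap.star_eq_adjoint, ContinuousLinearMap.adjoint_inner_left]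

lemma tensorForm_nonneg (σ : A →⋆ₐ[ℂ] (H →L[ℂ] H)) (x : E ⊗[ℂ] H) :
    0 ≤ RCLike.re (tensorForm E σ x x) := by
  obtain ⟨n, ξ, h, rfl⟩ : ∃ (n : ℕ) (ξ : Fin n → E) (h : Fin n → H),
      x = ∑ i, ξ i ⊗ₜ[ℂ] h i := by
    induction x using TensorProduct.induction_on with
    | zero => exact ⟨0, Fin.elim0, Fin.elim0, by simp⟩
    | tmul ξ h => exact ⟨1, fun _ => ξ, fun _ => h, by simp⟩
    | add x y hx hy =>
      obtain ⟨n, ξ, h, rfl⟩ := hx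
      obtain ⟨m, η, k, rfl⟩ := hy
      exact ⟨n + m, Fin.append ξ η, Fin.append h k, by simp [Fin.sum_univ_add]⟩
  have := gram_inner_nonneg σ ξ h
  simpa only [map_sum, LinearMap.sum_apply, tensorForm_tmul] using
    (by rw [Finset.sum_comm] at this; exact this :
      0 ≤ RCLike.re (∑ j, ∑ i, ⟪h i, σ (ip A (ξ i) (ξ j)) (h j)⟫_ℂ))

/-- The algebraic tensor product `E ⊗ H`, as a space with the semi-inner product `tensorForm`. -/
@[nolint unusedArguments]
def PreTensor (_σ : A →⋆ₐ[ℂ] (H →L[ℂ] H)) : Type _ := E ⊗[ℂ] H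

variable (σ : A →⋆ₐ[ℂ] (H →L[ℂ] H))

instance : AddCommGroup (PreTensor E σ) := inferInstanceAs (AddCommGroup (E ⊗[ℂ] H))
instance : Module ℂ (PreTensor E σ) := inferInstanceAs (Module ℂ (E ⊗[ℂ] H))

/-- The semi-inner product on the algebraic tensor product. -/
abbrev preTensorCore : PreInnerProductSpace.Core ℂ (PreTensor E σ) where
  inner x y := tensorForm E σ x y
  conj_inner_symm := tensorForm_conj_symm E σ
  re_inner_nonneg := tensorForm_nonneg E σ
  add_left x y z := LinearMap.map_add₂ (tensorForm E σ) x y z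
  smul_left x y c := LinearMap.map_smulₛₗ₂ (tensorForm E σ) c x y

instance : SeminormedAddCommGroup (PreTensor E σ) :=
  InnerProductSpace.Core.toSeminormedAddCommGroup (c := preTensorCore E σ)

instance : InnerProductSpace ℂ (PreTensor E σ) :=
  InnerProductSpace.ofCore (preTensorCore E σ)

/-- The Hilbert space `E ⊗_σ H`: the Hausdorff completion of the algebraic tensor product with
respect to `⟨ξ ⊗ h, η ⊗ k⟩ = ⟨h, σ(⟨ξ, η⟩) k⟩`. -/
abbrev CorrTensor : Type _ := UniformSpace.Completion (PreTensor E σ)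

variable {E} in
/-- The elementary tensor `ξ ⊗ h` in `E ⊗_σ H`. -/
def corrTmul (ξ : E) (h : H) : CorrTensor E σ :=
  ((show PreTensor E σ from ξ ⊗ₜ[ℂ] h : PreTensor E σ) : UniformSpace.Completion (PreTensor E σ))

lemma inner_corrTmul (ξ η : E) (h k : H) :
    ⟪corrTmul σ ξ h, corrTmul σ η k⟫_ℂ = ⟪h, σ (ip A ξ η) k⟫_ℂ :=
  UniformSpace.Completion.inner_coe _ _

end Tensor

/-! ### Representations -/

/-- A completely contractive covariant representation of the C*-correspondence `E` over `A` on the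
Hilbert space `H`.

The norm of `(x i j)` in `M_n(E)` is `‖(∑ k, ⟨x k i, x k j⟩)‖ ^ (1/2)`, with the C*-norm of
`M_n(A)`; the norm of `(S (x i j))` is that of an operator on the `n`-fold direct sum of `H`. -/
structure CorrRep (A E H : Type*) [CStarAlgebra A] [PartialOrder A] [StarOrderedRing A]
    [NormedAddCommGroup E] [NormedSpace ℂ E] [CompleteSpace E] [Module Aᵐᵒᵖ E]
    [CStarCorrespondence A E]
    [NormedAddCommGroup H] [InnerProductSpace ℂ H] [CompleteSpace H] where
  /-- The linear map `S` on the correspondence. -/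
  map : E →ₗ[ℂ] (H →L[ℂ] H)
  /-- The unital representation `σ` of the C*-algebra. -/
  alg : A →⋆ₐ[ℂ] (H →L[ℂ] H)
  covariant : ∀ (a : A) (ξ : E) (b : A),
    map (CStarCorrespondence.leftAction a (MulOpposite.op b • ξ)) = alg a * map ξ * alg b
  completely_contractive : ∀ (n : ℕ) (x : Fin n → Fin n → E) (h : Fin n → H),
    ∑ i, ‖∑ j, map (x i j) (h j)‖ ^ 2 ≤
      ‖(CStarMatrix.ofMatrix fun i j => ∑ k, ip A (x k i) (x k j) :
          CStarMatrix (Fin n) (Fin n) A)‖ * ∑ j, ‖h j‖ ^ 2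

instance {H : Type*} [NormedAddCommGroup H] [InnerProductSpace ℂ H] [CompleteSpace H]
    (V : ClosedSubmodule ℂ H) : CompleteSpace V.toSubmodule :=
  V.isClosed.completeSpace_coe

/-- The compression `P_V X|_V` of an operator to a closed subspace. -/
def compress {H : Type*} [NormedAddCommGroup H] [InnerProductSpace ℂ H] [CompleteSpace H]
    (V : ClosedSubmodule ℂ H) (X : H →L[ℂ] H) : V.toSubmodule →L[ℂ] V.toSubmodule :=
  V.toSubmodule.orthogonalProjectionOnto ∘L X ∘L V.toSubmodule.subtypeL

namespace CorrRep

variable {A E H K : Type*} [CStarAlgebra A] [PartialOrder A] [StarOrderedRing A]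
  [NormedAddCommGroup E] [NormedSpace ℂ E] [CompleteSpace E] [Module Aᵐᵒᵖ E]
  [CStarCorrespondence A E]
  [NormedAddCommGroup H] [InnerProductSpace ℂ H] [CompleteSpace H]
  [NormedAddCommGroup K] [InnerProductSpace ℂ K] [CompleteSpace K]

/-- `S(ξ)* S(η) = σ(⟨ξ, η⟩)`. -/
def IsIsometric (S : CorrRep A E H) : Prop :=
  ∀ ξ η : E, star (S.map ξ) * S.map η = S.alg (ip A ξ η)

/-- The operator `S̃ : E ⊗_σ H → H`, determined by `S̃ (ξ ⊗ h) = S(ξ) h`, is a coisometry. -/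
def IsFullyCoisometric (S : CorrRep A E H) : Prop :=
  ∃ St : CorrTensor E S.alg →L[ℂ] H,
    (∀ (ξ : E) (h : H), St (corrTmul S.alg ξ h) = S.map ξ h) ∧
      St ∘L ContinuousLinearMap.adjoint St = ContinuousLinearMap.id ℂ H

/-- Unitary equivalence: a unitary `U : H → K` intertwining both components. -/
def UnitarilyEquivalent (S : CorrRep A E H) (T : CorrRep A E K) : Prop :=
  ∃ U : H ≃ₗᵢ[ℂ] K,
    (∀ (ξ : E) (h : H), U (S.map ξ h) = T.map ξ (U h)) ∧
      ∀ (a : A) (h : H), U (S.alg a h) = T.alg a (U h)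

/-- The unital algebra generated by the operators `S(ξ)` and `σ(a)`. -/
def generatedAlgebra (S : CorrRep A E H) : Subalgebra ℂ (H →L[ℂ] H) :=
  Algebra.adjoin ℂ (Set.range S.map ∪ Set.range S.alg)

/-- The unital WOT-closed algebra generated by the representation. -/
def wotAlgebra (S : CorrRep A E H) : Set (H →L[ℂ] H) :=
  {X | (ContinuousLinearMapWOT.ofCLM X : H →WOT[ℂ] H) ∈
    closure (ContinuousLinearMapWOT.ofCLM '' (S.generatedAlgebra : Set (H →L[ℂ] H)))}

lemma generatedAlgebra_subset_wotAlgebra (S : CorrRep A E H) :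
    (S.generatedAlgebra : Set (H →L[ℂ] H)) ⊆ S.wotAlgebra :=
  fun X hX => subset_closure ⟨X, hX, rfl⟩

/-- `V` is invariant under the adjoints of the operators in the WOT-closed algebra. -/
def IsCoinvariant (S : CorrRep A E H) (V : ClosedSubmodule ℂ H) : Prop :=
  ∀ X ∈ S.wotAlgebra, ∀ v ∈ V, star X v ∈ V

/-- `V` is cyclic for the WOT-closed algebra `𝔖`: the vectors `X v` with `X ∈ 𝔖` and `v ∈ V` have
closed linear span `H`. -/
def IsCyclic (S : CorrRep A E H) (V : ClosedSubmodule ℂ H) : Prop :=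
  (Submodule.span ℂ {w : H | ∃ X ∈ S.wotAlgebra, ∃ v ∈ V, w = X v}).topologicalClosure = ⊤

/-- A coinvariant cyclic subspace none of whose proper subspaces is coinvariant and cyclic. -/
structure IsMinimalCyclicCoinvariant (S : CorrRep A E H) (V : ClosedSubmodule ℂ H) : Prop where
  coinvariant : S.IsCoinvariant V
  cyclic : S.IsCyclic V
  minimal : ∀ W : ClosedSubmodule ℂ H, W ≤ V → S.IsCoinvariant W → S.IsCyclic W → W = V

/-- `S` on `H` is a dilation of the representation `R` on the closed subspace `V` of `H`. -/
structure IsDilation (S : CorrRep A E H) (V : ClosedSubmodule ℂ H)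
    (R : CorrRep A E V.toSubmodule) : Prop where
  alg_apply : ∀ (a : A) (v : V.toSubmodule), S.alg a (v : H) = (R.alg a v : H)
  alg_orthogonal : ∀ (a : A), ∀ w ∈ V.toSubmoduleᗮ, S.alg a w ∈ V.toSubmoduleᗮ
  map_orthogonal : ∀ (ξ : E), ∀ w ∈ V.toSubmoduleᗮ, S.map ξ w ∈ V.toSubmoduleᗮ
  compress_map : ∀ ξ : E, compress V (S.map ξ) = R.map ξ

/-- The minimality condition `H = ⋁_{n ≥ 0} S̃_n(E^n ⊗ V)`: the vectors `S(ξ₁) ⋯ S(ξ_n) v` with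
`n ≥ 0`, `ξ_i ∈ E` and `v ∈ V` have closed linear span `H`. -/
def IsGeneratedBy (S : CorrRep A E H) (V : ClosedSubmodule ℂ H) : Prop :=
  (Submodule.span ℂ {w : H | ∃ (ξ : List E), ∃ v ∈ V,
    w = (ξ.map S.map).prod v}).topologicalClosure = ⊤

/-- `S` is the minimal isometric dilation of `R`. -/
structure IsMinimalIsometricDilation (S : CorrRep A E H) (V : ClosedSubmodule ℂ H)
    (R : CorrRep A E V.toSubmodule) : Prop where
  isometric : S.IsIsometric
  dilation : S.IsDilation V R
  minimal : S.IsGeneratedBy V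

/-- `S` is the minimal isometric dilation of a representation on a non-zero finite dimensional
subspace. -/
def IsFinitelyCorrelated (S : CorrRep A E H) : Prop :=
  ∃ V : ClosedSubmodule ℂ H, FiniteDimensional ℂ V.toSubmodule ∧ V.toSubmodule ≠ ⊥ ∧
    ∃ R : CorrRep A E V.toSubmodule, S.IsMinimalIsometricDilation V R

lemma IsCoinvariant.alg_mem {S : CorrRep A E H} {V : ClosedSubmodule ℂ H}
    (hV : S.IsCoinvariant V) (a : A) {v : H} (hv : v ∈ V) : S.alg a v ∈ V := by
  have h := hV (S.alg (star a)) (S.generatedAlgebra_subset_wotAlgebra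
    (Algebra.subset_adjoin (Or.inr ⟨star a, rfl⟩))) v hv
  rwa [← map_star, star_star] at h

lemma coe_compress_alg {S : CorrRep A E H} {V : ClosedSubmodule ℂ H}
    (hV : S.IsCoinvariant V) (a : A) (v : V.toSubmodule) :
    (compress V (S.alg a) v : H) = S.alg a (v : H) := by
  have : S.alg a (v : H) ∈ V.toSubmodule := hV.alg_mem a v.2
  simpa [compress] using
    congrArg Subtype.val (Submodule.orthogonalProjectionOnto_mem_subspace_eq_self
      (K := V.toSubmodule) ⟨_, this⟩)

lemma orthogonalProjection_alg {S : CorrRep A E H} {V : ClosedSubmodule ℂ H}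
    (hV : S.IsCoinvariant V) (a : A) (w : H) :
    V.toSubmodule.orthogonalProjectionOnto (S.alg a w)
      = compress V (S.alg a) (V.toSubmodule.orthogonalProjectionOnto w) := by
  refine ext_inner_right ℂ fun v => ?_
  have h1 : ∀ u : H, ⟪V.toSubmodule.orthogonalProjectionOnto u, v⟫_ℂ = ⟪u, (v : H)⟫_ℂ := fun u =>
    Submodule.inner_orthogonalProjectionOnto_eq_of_mem_right v u
  have h2 : S.alg (star a) (v : H) ∈ V.toSubmodule := hV.alg_mem (star a) v.2
  rw [h1, Submodule.coe_inner, coe_compress_alg hV, ← star_star a, map_star,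
    ContinuousLinearMap.star_eq_adjoint, ContinuousLinearMap.adjoint_inner_left,
    ContinuousLinearMap.adjoint_inner_left]
  exact (Submodule.inner_orthogonalProjectionOnto_eq_of_mem_right ⟨_, h2⟩ w).symm

/-- The restriction `σ(·)|_V`, equal to `P_V σ(·)|_V`, to a coinvariant subspace. -/
def compressAlg (S : CorrRep A E H) (V : ClosedSubmodule ℂ H) (hV : S.IsCoinvariant V) :
    A →⋆ₐ[ℂ] (V.toSubmodule →L[ℂ] V.toSubmodule) where
  toFun := fun a => compress V (S.alg a)
  map_one' := by ext v; rw [coe_compress_alg hV]; simp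
  map_mul' := fun a b => by ext v; rw [coe_compress_alg hV]; simp [coe_compress_alg hV]
  map_zero' := by ext v; rw [coe_compress_alg hV]; simp
  map_add' := fun a b => by ext v; rw [coe_compress_alg hV]; simp [coe_compress_alg hV]
  commutes' := fun c => by
    ext v; rw [coe_compress_alg hV]
    simp [Algebra.algebraMap_eq_smul_one]
  map_star' := fun a => by
    rw [ContinuousLinearMap.star_eq_adjoint, ContinuousLinearMap.eq_adjoint_iff]
    intro v w
    rw [Submodule.coe_inner, Submodule.coe_inner, coe_compress_alg hV, coe_compress_alg hV,
      map_star, ContinuousLinearMap.star_eq_adjoint, ContinuousLinearMap.adjoint_inner_left]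

/-- The compression `(P_V S(·)|_V, σ(·)|_V)` of a representation to a coinvariant subspace. -/
def compression (S : CorrRep A E H) (V : ClosedSubmodule ℂ H) (hV : S.IsCoinvariant V) :
    CorrRep A E V.toSubmodule where
  map :=
    { toFun := fun ξ => compress V (S.map ξ)
      map_add' := fun ξ η => by rw [map_add]; ext v; simp [compress]
      map_smul' := fun c ξ => by rw [map_smul]; ext v; simp [compress] }
  alg := S.compressAlg V hV
  covariant := fun a ξ b => by
    refine ContinuousLinearMap.ext fun v => ?_
    change V.toSubmodule.orthogonalProjectionOnto (S.map _ (v : H)) =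
      compress V (S.alg a) (V.toSubmodule.orthogonalProjectionOnto
        (S.map ξ ((compress V (S.alg b) v : V.toSubmodule) : H)))
    rw [S.covariant, coe_compress_alg hV, ← orthogonalProjection_alg hV]
    rfl
  completely_contractive := fun n x h => by
    refine le_trans (Finset.sum_le_sum fun i _ => ?_)
      (S.completely_contractive n x fun j => (h j : H))
    have : ∑ j, compress V (S.map (x i j)) (h j)
        = V.toSubmodule.orthogonalProjectionOnto (∑ j, S.map (x i j) (h j : H)) := by
      rw [map_sum]; rfl
    gcongr
    change ‖∑ j, compress V (S.map (x i j)) (h j)‖ ≤ _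
    rw [this]
    exact Submodule.norm_orthogonalProjectionOnto_apply_le _ _

end CorrRep

end

/-! The subspace sought is the socle of the finite dimensional space `V` supplied by finite
correlation: the sum of the minimal non-zero subspaces of `V` invariant under `σ(a)` and `S(ξ)*`. It
is the least cyclic coinvariant subspace, hence the only minimal one.

The main point is `wordSpan_closure_inf_eq_bot`: coinvariant subspaces `M`, `N` with `M ⊓ N = ⊥`,
`M` closed and `N` finite dimensional, generate closed invariant subspaces that still meet in zero.
Finite dimensionality puts `M` and `N` at a positive angle. Isometry carries this angle, with the
same constant, to the spans of `S(E) M` and `S(E) N`, since norms there are computed by a matrix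
over `A` acting through `σ`, which preserves `M` and `N`. Full coisometry makes the iterated spans
increase, so the uniform constant survives in the union and in its closure.

Consequently a cyclic coinvariant `W` meets every irreducible `N`, hence contains it by minimality
(`socle_le_of_cyclic`). If the socle generated only `L ≠ ⊤`, then `Lᗮ` would meet `V` and contain an
irreducible subspace of the socle, which is absurd (`socle_cyclic`).

For the equivalence, isometry reduces inner products of words applied to vectors of `V` to data of
the compression, so a unitary between compressions extends. Conversely, a unitary equivalence
carries least subspaces to least subspaces. -/

open CStarCorrespondence

/-! ### Subspaces at a positive angle -/

/-- `M` and `N` are at a positive angle, with constant `K`. -/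
def Submodule.IsSeparated {H : Type*} [NormedAddCommGroup H] [Module ℂ H]
    (K : ℝ) (M N : Submodule ℂ H) : Prop :=
  ∀ x ∈ M, ∀ y ∈ N, ‖y‖ ≤ K * ‖y - x‖

namespace Submodule

variable {H : Type*} [NormedAddCommGroup H] [InnerProductSpace ℂ H]

lemma IsSeparated.topologicalClosure {K : ℝ} {M N : Submodule ℂ H} (h : IsSeparated K M N) :
    IsSeparated K M.topologicalClosure N.topologicalClosure := by
  intro x hx y hy
  have hmem : (x, y) ∈ closure ((M : Set H) ×ˢ (N : Set H)) := by
    rw [closure_prod_eq]; exact ⟨hx, hy⟩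
  have hcl : IsClosed {p : H × H | ‖p.2‖ ≤ K * ‖p.2 - p.1‖} :=
    isClosed_le (by fun_prop) (by fun_prop)
  exact closure_minimal (fun p hp => h p.1 hp.1 p.2 hp.2) hcl hmem

lemma IsSeparated.eq_zero {K : ℝ} {M N : Submodule ℂ H} (h : IsSeparated K M N) {x : H}
    (hM : x ∈ M) (hN : x ∈ N) : x = 0 := by
  simpa using h x hM x hN

/-- The quotient map `H → H ⧸ M` is injective on `N`, and an injective linear map on a finite
dimensional space is bounded below. The quotient norm of `y` is at most `‖y - x‖` for `x ∈ M`. -/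
lemma exists_isSeparated {M N : Submodule ℂ H} (hM : IsClosed (M : Set H))
    [FiniteDimensional ℂ N] (h : M ⊓ N = ⊥) : ∃ K, 0 ≤ K ∧ IsSeparated K M N := by
  have := hM
  have hker : LinearMap.ker (M.mkQ ∘ₗ N.subtype) = ⊥ := by
    rw [LinearMap.ker_eq_bot']
    intro y hy
    have : (y : H) ∈ M ⊓ N := ⟨by simpa using hy, y.2⟩
    rw [h] at this
    simpa using this
  obtain ⟨K, -, hK⟩ := (M.mkQ ∘ₗ N.subtype).exists_antilipschitzWith hker
  refine ⟨K, K.2, fun x hx y hy => ?_⟩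
  have h1 := hK.le_mul_norm (map_zero _) (⟨y, hy⟩ : N)
  refine h1.trans ?_
  gcongr
  have h2 : (M.mkQ ∘ₗ N.subtype) ⟨y, hy⟩ = M.mkQ (y - x) := by
    simp [(Submodule.Quotient.mk_eq_zero M).2 hx]
  rw [h2]
  exact Submodule.Quotient.norm_mk_le M (y - x)

end Submodule

/-! ### Invariant and coinvariant subspaces -/

namespace CorrRep

variable {A E H : Type*} [CStarAlgebra A] [PartialOrder A] [StarOrderedRing A]
  [NormedAddCommGroup E] [NormedSpace ℂ E] [CompleteSpace E] [Module Aᵐᵒᵖ E]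
  [CStarCorrespondence A E]
  [NormedAddCommGroup H] [InnerProductSpace ℂ H] [CompleteSpace H]

lemma alg_mul_map (S : CorrRep A E H) (a : A) (ξ : E) :
    S.alg a * S.map ξ = S.map (leftAction a ξ) := by
  have := S.covariant a ξ 1
  simpa using this.symm

lemma alg_map_apply (S : CorrRep A E H) (a : A) (ξ : E) (h : H) :
    S.alg a (S.map ξ h) = S.map (leftAction a ξ) h :=
  congrArg (fun X : H →L[ℂ] H => X h) (S.alg_mul_map a ξ)

lemma inner_alg_left (S : CorrRep A E H) (a : A) (x y : H) :
    ⟪S.alg a x, y⟫_ℂ = ⟪x, S.alg (star a) y⟫_ℂ := by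
  rw [map_star, ContinuousLinearMap.star_eq_adjoint, ContinuousLinearMap.adjoint_inner_right]

lemma IsIsometric.inner_map_map {S : CorrRep A E H} (hS : S.IsIsometric) (ξ η : E) (x y : H) :
    ⟪S.map ξ x, S.map η y⟫_ℂ = ⟪x, S.alg (ip A ξ η) y⟫_ℂ := by
  rw [← hS, ← ContinuousLinearMap.adjoint_inner_right]; rfl

/-- `W` is invariant under the `C*`-algebra part of the representation. -/
def AlgInvariant (S : CorrRep A E H) (W : Submodule ℂ H) : Prop :=
  ∀ a, ∀ w ∈ W, S.alg a w ∈ W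

/-- `W` is invariant under `σ(a)` and `S(ξ)*`. -/
structure StarInvariant (S : CorrRep A E H) (W : Submodule ℂ H) : Prop where
  alg : S.AlgInvariant W
  map : ∀ ξ, ∀ w ∈ W, star (S.map ξ) w ∈ W

/-- `W` is invariant under `σ(a)` and `S(ξ)`. -/
structure Invariant (S : CorrRep A E H) (W : Submodule ℂ H) : Prop where
  alg : S.AlgInvariant W
  map : ∀ ξ, ∀ w ∈ W, S.map ξ w ∈ W

lemma AlgInvariant.orthogonal {S : CorrRep A E H} {W : Submodule ℂ H} (hW : S.AlgInvariant W) :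
    S.AlgInvariant Wᗮ := by
  intro a w hw u hu
  rw [← star_star a, ← inner_alg_left]
  exact hw _ (hW _ u hu)

lemma Invariant.orthogonal {S : CorrRep A E H} {W : Submodule ℂ H} (hW : S.Invariant W) :
    S.StarInvariant Wᗮ := by
  refine ⟨hW.alg.orthogonal, fun ξ w hw u hu => ?_⟩
  rw [ContinuousLinearMap.star_eq_adjoint, ContinuousLinearMap.adjoint_inner_right]
  exact hw _ (hW.map ξ u hu)

lemma StarInvariant.orthogonal {S : CorrRep A E H} {W : Submodule ℂ H} (hW : S.StarInvariant W) :
    S.Invariant Wᗮ := by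
  refine ⟨hW.alg.orthogonal, fun ξ w hw u hu => ?_⟩
  rw [← ContinuousLinearMap.adjoint_inner_left]
  exact hw _ (hW.map ξ u hu)

lemma AlgInvariant.topologicalClosure {S : CorrRep A E H} {W : Submodule ℂ H}
    (hW : S.AlgInvariant W) : S.AlgInvariant W.topologicalClosure := fun a _ hw =>
  map_mem_closure (S.alg a).continuous hw (hW a)

lemma Invariant.topologicalClosure {S : CorrRep A E H} {W : Submodule ℂ H}
    (hW : S.Invariant W) : S.Invariant W.topologicalClosure :=
  ⟨hW.alg.topologicalClosure, fun ξ _ hw => map_mem_closure (S.map ξ).continuous hw (hW.map ξ)⟩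

lemma StarInvariant.inf {S : CorrRep A E H} {V W : Submodule ℂ H} (hV : S.StarInvariant V)
    (hW : S.StarInvariant W) : S.StarInvariant (V ⊓ W) :=
  ⟨fun a w hw => ⟨hV.alg a w hw.1, hW.alg a w hw.2⟩,
    fun ξ w hw => ⟨hV.map ξ w hw.1, hW.map ξ w hw.2⟩⟩

lemma starInvariant_sSup {S : CorrRep A E H} {s : Set (Submodule ℂ H)}
    (hs : ∀ W ∈ s, S.StarInvariant W) : S.StarInvariant (sSup s) := by
  refine ⟨fun a => ?_, fun ξ => ?_⟩
  · change sSup s ≤ (sSup s).comap (S.alg a : H →ₗ[ℂ] H)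
    exact sSup_le fun W hW w hw => le_sSup hW ((hs W hW).alg a w hw)
  · change sSup s ≤ (sSup s).comap (star (S.map ξ) : H →L[ℂ] H).toLinearMap
    exact sSup_le fun W hW w hw => le_sSup hW ((hs W hW).map ξ w hw)

/-- Invariance passes to the weak operator closed algebra. -/
lemma Invariant.wotAlgebra_mem {S : CorrRep A E H} {W : Submodule ℂ H} (hW : S.Invariant W)
    (hcl : IsClosed (W : Set H)) {X : H →L[ℂ] H} (hX : X ∈ S.wotAlgebra) {w : H} (hw : w ∈ W) :
    X w ∈ W := by
  have hgen : ∀ Y ∈ S.generatedAlgebra, ∀ w ∈ W, Y w ∈ W := by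
    intro Y hY
    induction hY using Algebra.adjoin_induction with
    | mem Y hY =>
      rcases hY with ⟨ξ, rfl⟩ | ⟨a, rfl⟩
      exacts [hW.map ξ, hW.alg a]
    | algebraMap c =>
      intro w hw
      simpa [Algebra.algebraMap_eq_smul_one] using W.smul_mem c hw
    | add Y Z _ _ hY hZ => exact fun w hw => W.add_mem (hY w hw) (hZ w hw)
    | mul Y Z _ _ hY hZ => exact fun w hw => hY _ (hZ w hw)
  have : CompleteSpace W := hcl.completeSpace_coe
  -- For fixed `u ∈ Wᗮ`, the condition `⟪u, Y w⟫ = 0` is weak operator closed in `Y`.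
  rw [← W.orthogonal_orthogonal]
  intro u hu
  have hc : IsClosed {Y : H →WOT[ℂ] H | ⟪u, Y w⟫_ℂ = 0} :=
    isClosed_eq (ContinuousLinearMapWOT.continuous_dual_apply w (innerSL ℂ u)) continuous_const
  refine closure_minimal ?_ hc hX
  rintro _ ⟨Y, hY, rfl⟩
  exact (W.mem_orthogonal' u).1 hu _ (hgen Y hY w hw)

/-- Reduces coinvariance to the generators: adjoints on `V` correspond to the operators themselves
on `Vᗮ`, where invariance passes to the weak operator closure. -/
lemma isCoinvariant_iff (S : CorrRep A E H) (V : ClosedSubmodule ℂ H) :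
    S.IsCoinvariant V ↔ S.StarInvariant V.toSubmodule := by
  constructor
  · refine fun h => ⟨fun a v hv => h.alg_mem a hv, fun ξ v hv => ?_⟩
    exact h (S.map ξ) (S.generatedAlgebra_subset_wotAlgebra
      (Algebra.subset_adjoin (Or.inl ⟨ξ, rfl⟩))) v hv
  · intro h X hX v hv
    change _ ∈ V.toSubmodule
    rw [← V.toSubmodule.orthogonal_orthogonal]
    intro u hu
    rw [ContinuousLinearMap.star_eq_adjoint, ContinuousLinearMap.adjoint_inner_right]
    exact V.toSubmodule.inner_left_of_mem_orthogonal hv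
      (h.orthogonal.wotAlgebra_mem V.toSubmodule.isClosed_orthogonal hX hu)

/-! ### Words and cyclicity -/

/-- The linear span of the vectors `S(ξ₁) ⋯ S(ξ_n) v` with `v ∈ V`. -/
def wordSpan (S : CorrRep A E H) (V : Submodule ℂ H) : Submodule ℂ H :=
  Submodule.span ℂ {w : H | ∃ (ξ : List E), ∃ v ∈ V, w = (ξ.map S.map).prod v}

lemma le_wordSpan (S : CorrRep A E H) (V : Submodule ℂ H) : V ≤ S.wordSpan V :=
  fun v hv => Submodule.subset_span ⟨[], v, hv, by simp⟩

/-- Covariance absorbs `σ(a)` into the first letter; for the empty word it acts on `v`. -/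
lemma AlgInvariant.alg_word_mem {S : CorrRep A E H} {V : Submodule ℂ H} (hV : S.AlgInvariant V)
    (a : A) (ξ : List E) {v : H} (hv : v ∈ V) :
    ∃ (η : List E), ∃ w ∈ V, S.alg a ((ξ.map S.map).prod v) = (η.map S.map).prod w := by
  cases ξ with
  | nil => exact ⟨[], S.alg a v, hV a v hv, by simp⟩
  | cons x ξ => exact ⟨leftAction a x :: ξ, v, hv, by simp [alg_map_apply]⟩

lemma AlgInvariant.invariant_wordSpan {S : CorrRep A E H} {V : Submodule ℂ H}
    (hV : S.AlgInvariant V) : S.Invariant (S.wordSpan V) := by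
  refine ⟨fun a => ?_, fun ξ => ?_⟩
  · change S.wordSpan V ≤ (S.wordSpan V).comap (S.alg a : H →ₗ[ℂ] H)
    refine Submodule.span_le.2 ?_
    rintro _ ⟨ξ, v, hv, rfl⟩
    obtain ⟨η, w, hw, h⟩ := hV.alg_word_mem a ξ hv
    exact Submodule.subset_span ⟨η, w, hw, h⟩
  · change S.wordSpan V ≤ (S.wordSpan V).comap (S.map ξ : H →ₗ[ℂ] H)
    refine Submodule.span_le.2 ?_
    rintro _ ⟨η, v, hv, rfl⟩
    exact Submodule.subset_span ⟨ξ :: η, v, hv, by simp⟩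

lemma word_mem_generatedAlgebra (S : CorrRep A E H) (ξ : List E) :
    (ξ.map S.map).prod ∈ S.generatedAlgebra := by
  refine Subalgebra.list_prod_mem _ fun X hX => ?_
  obtain ⟨x, -, rfl⟩ := List.mem_map.1 hX
  exact Algebra.subset_adjoin (Or.inl ⟨x, rfl⟩)

/-- The closed word span is invariant under the generators, hence under the whole weak operator
closed algebra; conversely, words belong to that algebra. -/
lemma isCyclic_iff (S : CorrRep A E H) (V : ClosedSubmodule ℂ H)
    (hV : S.AlgInvariant V.toSubmodule) :
    S.IsCyclic V ↔ (S.wordSpan V.toSubmodule).topologicalClosure = ⊤ := by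
  constructor
  · intro h
    rw [eq_top_iff, ← h]
    refine Submodule.topologicalClosure_minimal _ (Submodule.span_le.2 ?_)
      (Submodule.isClosed_topologicalClosure _)
    rintro _ ⟨X, hX, v, hv, rfl⟩
    exact hV.invariant_wordSpan.topologicalClosure.wotAlgebra_mem
      (Submodule.isClosed_topologicalClosure _) hX
      (Submodule.le_topologicalClosure _ (S.le_wordSpan _ hv))
  · intro h
    rw [IsCyclic, eq_top_iff, ← h]
    refine Submodule.topologicalClosure_mono (Submodule.span_mono ?_)
    rintro _ ⟨ξ, v, hv, rfl⟩
    exact ⟨_, S.generatedAlgebra_subset_wotAlgebra (S.word_mem_generatedAlgebra ξ), v, hv, rfl⟩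

lemma IsDilation.starInvariant {S : CorrRep A E H} {V : ClosedSubmodule ℂ H}
    {R : CorrRep A E V.toSubmodule} (h : S.IsDilation V R) : S.StarInvariant V.toSubmodule := by
  refine ⟨fun a v hv => ?_, fun ξ v hv => ?_⟩
  · rw [h.alg_apply a ⟨v, hv⟩]; exact (R.alg a _).2
  · rw [← V.toSubmodule.orthogonal_orthogonal]
    intro u hu
    rw [ContinuousLinearMap.star_eq_adjoint, ContinuousLinearMap.adjoint_inner_right]
    exact V.toSubmodule.inner_left_of_mem_orthogonal hv (h.map_orthogonal ξ u hu)

/-! ### Full coisometry and the shift of a subspace -/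

lemma IsFullyCoisometric.span_dense {S : CorrRep A E H} (hS : S.IsFullyCoisometric) :
    (Submodule.span ℂ {w : H | ∃ ξ h, w = S.map ξ h}).topologicalClosure = ⊤ := by
  obtain ⟨St, hSt, hco⟩ := hS
  rw [Submodule.topologicalClosure_eq_top_iff, eq_bot_iff]
  intro x hx
  -- Orthogonality to `S(ξ) h` extends from elementary tensors to sums and, by continuity, to the
  -- completion. Then `x = S̃ S̃* x` is orthogonal to itself.
  have hker : ∀ z : CorrTensor E S.alg, ⟪x, St z⟫_ℂ = 0 := by
    intro z
    induction z using UniformSpace.Completion.induction_on with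
    | hp => exact isClosed_eq (by fun_prop) continuous_const
    | ih z =>
      induction z using TensorProduct.induction_on with
      | zero =>
        have : ((0 : PreTensor E S.alg) : CorrTensor E S.alg) = 0 :=
          UniformSpace.Completion.coe_zero
        exact (congrArg (fun z => ⟪x, St z⟫_ℂ) this).trans (by simp)
      | tmul ξ h =>
        have := hSt ξ h
        refine (congrArg (fun z => ⟪x, z⟫_ℂ) this).trans ?_
        exact (Submodule.mem_orthogonal' _ _).1 hx _ (Submodule.subset_span ⟨ξ, h, rfl⟩)
      | add y z hy hz =>
        have := UniformSpace.Completion.coe_add (α := PreTensor E S.alg) y z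
        refine (congrArg (fun z => ⟪x, St z⟫_ℂ) this).trans ?_
        rw [map_add, inner_add_right, hy, hz, add_zero]
  have h1 := hker (ContinuousLinearMap.adjoint St x)
  have h2 : St (ContinuousLinearMap.adjoint St x) = x :=
    congrArg (fun X : H →L[ℂ] H => X x) hco
  rw [h2] at h1
  simpa using h1

/-- The linear span of the vectors `S(ξ) w` with `w ∈ W`. -/
def range (S : CorrRep A E H) (W : Submodule ℂ H) : Submodule ℂ H :=
  Submodule.span ℂ {x : H | ∃ ξ, ∃ w ∈ W, x = S.map ξ w}

/-- The closed linear span of the vectors `S(ξ) w` with `w ∈ W`. -/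
def shift (S : CorrRep A E H) (W : Submodule ℂ H) : Submodule ℂ H :=
  (S.range W).topologicalClosure

lemma shift_mono (S : CorrRep A E H) : Monotone S.shift := fun _ _ h =>
  Submodule.topologicalClosure_mono <| Submodule.span_mono <| by
    rintro _ ⟨ξ, w, hw, rfl⟩; exact ⟨ξ, w, h hw, rfl⟩

lemma map_mem_shift (S : CorrRep A E H) {W : Submodule ℂ H} (ξ : E) {w : H} (hw : w ∈ W) :
    S.map ξ w ∈ S.shift W :=
  Submodule.le_topologicalClosure _ (Submodule.subset_span ⟨ξ, w, hw, rfl⟩)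

lemma algInvariant_shift (S : CorrRep A E H) (W : Submodule ℂ H) : S.AlgInvariant (S.shift W) := by
  refine AlgInvariant.topologicalClosure fun a => ?_
  change S.range W ≤ (S.range W).comap (S.alg a : H →ₗ[ℂ] H)
  refine Submodule.span_le.2 ?_
  rintro _ ⟨ξ, v, hv, rfl⟩
  exact Submodule.subset_span ⟨leftAction a ξ, v, hv, S.alg_map_apply a ξ v⟩

/-- The norm of `∑ S(ξᵢ) hᵢ` is computed by a square root of the Gram matrix of the `ξᵢ`. -/
lemma IsIsometric.exists_norm_sum_sq {S : CorrRep A E H} (hS : S.IsIsometric) {n : ℕ}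
    (ξ : Fin n → E) : ∃ B : Fin n → Fin n → A, ∀ h : Fin n → H,
      ‖∑ i, S.map (ξ i) (h i)‖ ^ 2 = ∑ k, ‖∑ j, S.alg (B k j) (h j)‖ ^ 2 := by
  obtain ⟨B, hB⟩ := exists_eq_star_mul_self (gram_nonneg A ξ)
  have hij : ∀ i j, ip A (ξ i) (ξ j) = ∑ k, star (B k i) * B k j := by
    intro i j
    have := congrArg (fun M : CStarMatrix (Fin n) (Fin n) A => M i j) hB
    simp only [CStarMatrix.mul_apply, CStarMatrix.star_apply] at this
    exact this
  refine ⟨fun k j => B k j, fun h => ?_⟩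
  have key : ⟪∑ i, S.map (ξ i) (h i), ∑ j, S.map (ξ j) (h j)⟫_ℂ
      = ∑ k, ⟪∑ i, S.alg (B k i) (h i), ∑ j, S.alg (B k j) (h j)⟫_ℂ := by
    simp only [sum_inner, inner_sum, hS.inner_map_map, hij, map_sum, sum_apply, inner_alg_left,
      map_mul, mul_apply_eq_comp]
    rw [Finset.sum_comm_cycle]
  simp only [inner_self_eq_norm_sq_to_K] at key
  exact_mod_cast key

/-- Padding with zeros gives both vectors the same letters `ξ i`, so one Gram matrix computes the
norms of `y` and `y - x`. -/
lemma exists_sum_of_mem_range (S : CorrRep A E H) {M N : Submodule ℂ H} {x y : H}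
    (hx : x ∈ S.range M) (hy : y ∈ S.range N) :
    ∃ (n : ℕ) (ξ : Fin n → E) (u v : Fin n → H), (∀ i, u i ∈ M) ∧ (∀ i, v i ∈ N) ∧
      x = ∑ i, S.map (ξ i) (u i) ∧ y = ∑ i, S.map (ξ i) (v i) := by
  have one : ∀ (M : Submodule ℂ H) (x : H), x ∈ S.range M →
      ∃ (n : ℕ) (ξ : Fin n → E) (u : Fin n → H), (∀ i, u i ∈ M) ∧
        x = ∑ i, S.map (ξ i) (u i) := by
    intro M x hx
    induction hx using Submodule.span_induction with
    | mem x hx =>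
      obtain ⟨ξ, w, hw, rfl⟩ := hx
      exact ⟨1, fun _ => ξ, fun _ => w, fun _ => hw, by simp⟩
    | zero => exact ⟨0, Fin.elim0, Fin.elim0, fun i => i.elim0, by simp⟩
    | add x y _ _ hx hy =>
      obtain ⟨n, ξ, h, hh, rfl⟩ := hx
      obtain ⟨m, η, k, hk, rfl⟩ := hy
      refine ⟨n + m, Fin.append ξ η, Fin.append h k, fun i => ?_, by simp [Fin.sum_univ_add]⟩
      induction i using Fin.addCases <;> simp [hh, hk]
    | smul c x _ hx =>
      obtain ⟨n, ξ, h, hh, rfl⟩ := hx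
      exact ⟨n, ξ, fun i => c • h i, fun i => M.smul_mem c (hh i), by simp [Finset.smul_sum]⟩
  obtain ⟨n, ξ, h, hh, rfl⟩ := one M x hx
  obtain ⟨m, η, k, hk, rfl⟩ := one N y hy
  refine ⟨n + m, Fin.append ξ η, Fin.append h 0, Fin.append 0 k, fun i => ?_, fun i => ?_,
    by simp [Fin.sum_univ_add], by simp [Fin.sum_univ_add]⟩
  all_goals induction i using Fin.addCases <;> simp [hh, hk]

/-- The entries of the square root of the Gram matrix act through `σ` and preserve `M` and `N`. The
given inequality therefore applies to each row, and summing squares keeps the constant `C`. -/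
lemma IsIsometric.isSeparated_shift {S : CorrRep A E H} (hS : S.IsIsometric) {C : ℝ} (hC : 0 ≤ C)
    {M N : Submodule ℂ H} (hM : S.AlgInvariant M) (hN : S.AlgInvariant N)
    (h : Submodule.IsSeparated C M N) : Submodule.IsSeparated C (S.shift M) (S.shift N) := by
  refine Submodule.IsSeparated.topologicalClosure fun x hx y hy => ?_
  obtain ⟨n, ξ, u, v, hu, hv, rfl, rfl⟩ := S.exists_sum_of_mem_range hx hy
  obtain ⟨B, hB⟩ := hS.exists_norm_sum_sq ξ
  refine (sq_le_sq₀ (norm_nonneg _) (by positivity)).1 ?_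
  rw [← Finset.sum_sub_distrib]
  simp only [← map_sub]
  rw [mul_pow, hB, hB, Finset.mul_sum]
  refine Finset.sum_le_sum fun k _ => ?_
  rw [← mul_pow]
  simp only [map_sub, Finset.sum_sub_distrib]
  gcongr
  exact h _ (M.sum_mem fun j _ => hM _ _ (hu j)) _ (N.sum_mem fun j _ => hN _ _ (hv j))

/-- `⟪S(η) w, S(ξ) u⟫ = ⟪w, σ(⟨η, ξ⟩) u⟫`, and `Wᗮ` is invariant under `σ`. -/
lemma IsIsometric.map_mem_shift_orthogonal {S : CorrRep A E H} (hS : S.IsIsometric)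
    {W : Submodule ℂ H} (hW : S.AlgInvariant W) (ξ : E) {u : H} (hu : u ∈ Wᗮ) :
    S.map ξ u ∈ (S.shift W)ᗮ := by
  rw [shift, Submodule.orthogonal_closure, Submodule.mem_orthogonal]
  intro x hx
  induction hx using Submodule.span_induction with
  | mem x hx =>
    obtain ⟨η, w, hw, rfl⟩ := hx
    rw [hS.inner_map_map]
    exact hW.orthogonal _ u hu w hw
  | zero => simp
  | add x y _ _ hx hy => rw [inner_add_left, hx, hy, add_zero]
  | smul c x _ hx => rw [inner_smul_left, hx, mul_zero]

/-- A closed subspace invariant under the adjoints lies in its shift when the representation is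
isometric and fully coisometric. -/
lemma StarInvariant.le_shift {S : CorrRep A E H} (hS : S.IsIsometric) (hco : S.IsFullyCoisometric)
    {W : Submodule ℂ H} (hcl : IsClosed (W : Set H)) (hW : S.StarInvariant W) :
    W ≤ S.shift W := by
  intro w hw
  have : CompleteSpace W := hcl.completeSpace_coe
  have : CompleteSpace (S.shift W) := (Submodule.isClosed_topologicalClosure _).completeSpace_coe
  obtain ⟨p, hp, q, hq, rfl⟩ := (S.shift W).exists_add_mem_mem_orthogonal w
  suffices q = 0 by simpa [this] using hp
  -- Split `h = v + u` along `W ⊕ Wᗮ`. The vector `S(ξ) v` lies in the shift, so it is orthogonal to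
  -- `q`. The vector `S(ξ) u` is orthogonal to `p`, which lies in the shift, and to `p + q ∈ W` by
  -- coinvariance, hence to `q`.
  have hq' : q ∈ (Submodule.span ℂ {w : H | ∃ ξ h, w = S.map ξ h})ᗮ := by
    intro x hx
    induction hx using Submodule.span_induction with
    | mem x hx =>
      obtain ⟨ξ, h, rfl⟩ := hx
      obtain ⟨v, hv, u, hu, rfl⟩ := W.exists_add_mem_mem_orthogonal h
      have h1 := hS.map_mem_shift_orthogonal hW.alg ξ hu
      have h2 : ⟪S.map ξ u, p + q⟫_ℂ = 0 :=
        Submodule.inner_left_of_mem_orthogonal hw (hW.orthogonal.map ξ u hu)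
      rw [inner_add_right, Submodule.inner_left_of_mem_orthogonal hp h1, zero_add] at h2
      rw [map_add, inner_add_left, h2, add_zero]
      exact hq _ (S.map_mem_shift ξ hv)
    | zero => simp
    | add x y _ _ hx hy => rw [inner_add_left, hx, hy, add_zero]
    | smul c x _ hx => rw [inner_smul_left, hx, mul_zero]
  have h := (Submodule.topologicalClosure_eq_top_iff).1 hco.span_dense
  rw [h] at hq'
  simpa using hq'

/-! ### Disjointness of generated subspaces -/

lemma wordSpan_le_iSup_shift (S : CorrRep A E H) (W : Submodule ℂ H) :
    S.wordSpan W ≤ ⨆ n, S.shift^[n] W := by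
  refine Submodule.span_le.2 ?_
  rintro _ ⟨ξ, v, hv, rfl⟩
  have : (ξ.map S.map).prod v ∈ S.shift^[ξ.length] W := by
    induction ξ with
    | nil => simpa
    | cons x ξ ih =>
      rw [List.length_cons, Function.iterate_succ_apply']
      simpa using S.map_mem_shift x ih
  exact Submodule.mem_iSup_of_mem _ this

lemma AlgInvariant.iterate_shift {S : CorrRep A E H} {W : Submodule ℂ H} (hW : S.AlgInvariant W)
    (n : ℕ) : S.AlgInvariant (S.shift^[n] W) := by
  cases n with
  | zero => exact hW
  | succ n => rw [Function.iterate_succ_apply']; exact S.algInvariant_shift _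

lemma IsIsometric.isSeparated_iterate_shift {S : CorrRep A E H} (hS : S.IsIsometric) {C : ℝ}
    (hC : 0 ≤ C) {M N : Submodule ℂ H} (hM : S.AlgInvariant M) (hN : S.AlgInvariant N)
    (h : Submodule.IsSeparated C M N) (n : ℕ) :
    Submodule.IsSeparated C (S.shift^[n] M) (S.shift^[n] N) := by
  induction n with
  | zero => exact h
  | succ n ih =>
    simp only [Function.iterate_succ_apply']
    exact hS.isSeparated_shift hC (hM.iterate_shift n) (hN.iterate_shift n) ih

/-- Closed subspaces invariant under the adjoints, one of them finite dimensional, which meet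
only in zero generate closed invariant subspaces which meet only in zero. -/
lemma wordSpan_closure_inf_eq_bot {S : CorrRep A E H} (hS : S.IsIsometric)
    (hco : S.IsFullyCoisometric) {M N : Submodule ℂ H} (hMcl : IsClosed (M : Set H))
    [FiniteDimensional ℂ N] (hM : S.StarInvariant M) (hN : S.StarInvariant N) (h : M ⊓ N = ⊥) :
    (S.wordSpan M).topologicalClosure ⊓ (S.wordSpan N).topologicalClosure = ⊥ := by
  obtain ⟨C, hC, hsep⟩ := Submodule.exists_isSeparated hMcl h
  have mono : ∀ W : Submodule ℂ H, W ≤ S.shift W → Monotone fun n => S.shift^[n] W := fun W hW =>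
    S.shift_mono.monotone_iterate_of_le_map hW
  have hMm := mono M (hM.le_shift hS hco hMcl)
  have hNm := mono N (hN.le_shift hS hco N.closed_of_finiteDimensional)
  -- The iterates increase, so any two vectors of the suprema lie in iterates of a common order; `C`
  -- does not depend on that order.
  have hsup : Submodule.IsSeparated C (⨆ n, S.shift^[n] M) (⨆ n, S.shift^[n] N) := by
    intro x hx y hy
    obtain ⟨n, hn⟩ := (Submodule.mem_iSup_of_directed _ hMm.directed_le).1 hx
    obtain ⟨m, hm⟩ := (Submodule.mem_iSup_of_directed _ hNm.directed_le).1 hy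
    exact hS.isSeparated_iterate_shift hC hM.alg hN.alg hsep (max n m)
      x (hMm (le_max_left n m) hn) y (hNm (le_max_right n m) hm)
  rw [eq_bot_iff]
  rintro x ⟨hx, hy⟩
  exact hsup.topologicalClosure.eq_zero
    (Submodule.topologicalClosure_mono (S.wordSpan_le_iSup_shift M) hx)
    (Submodule.topologicalClosure_mono (S.wordSpan_le_iSup_shift N) hy)

lemma le_wordSpan_closure (S : CorrRep A E H) (V : Submodule ℂ H) :
    V ≤ (S.wordSpan V).topologicalClosure :=
  (S.le_wordSpan V).trans (Submodule.le_topologicalClosure _)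

/-! ### The socle as least cyclic coinvariant subspace -/

/-- A minimal non-zero subspace invariant under the adjoints. -/
def IsIrreducible (S : CorrRep A E H) (N : Submodule ℂ H) : Prop :=
  Minimal (fun N => S.StarInvariant N ∧ N ≠ ⊥) N

lemma StarInvariant.exists_isIrreducible_le {S : CorrRep A E H} {N : Submodule ℂ H}
    [FiniteDimensional ℂ N] (hN : S.StarInvariant N) (h0 : N ≠ ⊥) :
    ∃ N' ≤ N, S.IsIrreducible N' := by
  induction hd : Module.finrank ℂ N using Nat.strong_induction_on generalizing N with
  | _ d ih =>
    by_cases hmin : S.IsIrreducible N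
    · exact ⟨N, le_rfl, hmin⟩
    · have : ∃ N' < N, S.StarInvariant N' ∧ N' ≠ ⊥ := by
        by_contra! hcon
        refine hmin ⟨⟨hN, h0⟩, fun N' hN' hle => ?_⟩
        by_contra hlt
        exact hN'.2 (hcon N' (lt_of_le_not_ge hle hlt) hN'.1)
      obtain ⟨N', hlt, hN', h0'⟩ := this
      have : FiniteDimensional ℂ N' := Submodule.finiteDimensional_of_le hlt.le
      obtain ⟨N'', hle, hirr⟩ :=
        ih _ (hd ▸ Submodule.finrank_lt_finrank_of_lt hlt) hN' h0' rfl
      exact ⟨N'', hle.trans hlt.le, hirr⟩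

/-- The sum of the irreducible subspaces of `V`. -/
def socle (S : CorrRep A E H) (V : Submodule ℂ H) : Submodule ℂ H :=
  sSup {N | N ≤ V ∧ S.IsIrreducible N}

lemma socle_le (S : CorrRep A E H) (V : Submodule ℂ H) : S.socle V ≤ V :=
  sSup_le fun _ h => h.1

lemma starInvariant_socle (S : CorrRep A E H) (V : Submodule ℂ H) :
    S.StarInvariant (S.socle V) :=
  starInvariant_sSup fun _ h => h.2.prop.1

/-- The socle of `V` is contained in every closed cyclic subspace invariant under the adjoints. -/
lemma socle_le_of_cyclic {S : CorrRep A E H} (hS : S.IsIsometric) (hco : S.IsFullyCoisometric)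
    {V W : Submodule ℂ H} [FiniteDimensional ℂ V] (hWcl : IsClosed (W : Set H))
    (hW : S.StarInvariant W) (hcyc : (S.wordSpan W).topologicalClosure = ⊤) :
    S.socle V ≤ W := by
  refine sSup_le fun N ⟨hNV, hN⟩ => ?_
  have : FiniteDimensional ℂ N := Submodule.finiteDimensional_of_le hNV
  -- A trivial intersection would make the space generated by `N` meet `⊤` in zero. A non-trivial
  -- one equals `N` by minimality.
  by_cases h : W ⊓ N = ⊥
  · have := wordSpan_closure_inf_eq_bot hS hco hWcl hW hN.prop.1 h
    rw [hcyc, top_inf_eq] at this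
    exact absurd (eq_bot_iff.2 (this ▸ S.le_wordSpan_closure N)) hN.prop.2
  · exact (hN.le_of_le ⟨hW.inf hN.prop.1, h⟩ inf_le_right).trans inf_le_left

/-- The socle of a finite dimensional cyclic subspace is cyclic. -/
lemma socle_cyclic {S : CorrRep A E H} (hS : S.IsIsometric) (hco : S.IsFullyCoisometric)
    {V : Submodule ℂ H} [FiniteDimensional ℂ V] (hV : S.StarInvariant V)
    (hcyc : (S.wordSpan V).topologicalClosure = ⊤) :
    (S.wordSpan (S.socle V)).topologicalClosure = ⊤ := by
  set L := (S.wordSpan (S.socle V)).topologicalClosure with hL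
  have hLinv : S.Invariant L :=
    (S.starInvariant_socle V).alg.invariant_wordSpan.topologicalClosure
  have : CompleteSpace L := (Submodule.isClosed_topologicalClosure _).completeSpace_coe
  rw [← Submodule.orthogonal_eq_bot_iff]
  -- `Lᗮ` is closed and coinvariant but may be infinite dimensional, while `V` is cyclic. A trivial
  -- intersection thus gives `Lᗮ = ⊥`; otherwise an irreducible subspace lies in both `L` and `Lᗮ`.
  by_cases h : Lᗮ ⊓ V = ⊥
  · have := wordSpan_closure_inf_eq_bot hS hco L.isClosed_orthogonal hLinv.orthogonal hV h
    rw [hcyc, inf_top_eq] at this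
    exact eq_bot_iff.2 (this ▸ S.le_wordSpan_closure _)
  · have : FiniteDimensional ℂ (Lᗮ ⊓ V : Submodule ℂ H) :=
      Submodule.finiteDimensional_of_le inf_le_right
    obtain ⟨N, hN, hirr⟩ := (hLinv.orthogonal.inf hV).exists_isIrreducible_le h
    have h1 : N ≤ L := (le_sSup ⟨hN.trans inf_le_right, hirr⟩ : N ≤ S.socle V).trans
      (S.le_wordSpan_closure _)
    have h2 := le_inf h1 (hN.trans inf_le_left)
    rw [Submodule.inf_orthogonal_eq_bot] at h2
    exact absurd (eq_bot_iff.2 h2) hirr.prop.2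

/-- A finitely correlated, isometric, fully coisometric representation has a least cyclic
coinvariant subspace, and it is finite dimensional. -/
theorem IsFinitelyCorrelated.exists_least {S : CorrRep A E H} (hfc : S.IsFinitelyCorrelated)
    (hS : S.IsIsometric) (hco : S.IsFullyCoisometric) :
    ∃ V : ClosedSubmodule ℂ H, FiniteDimensional ℂ V.toSubmodule ∧
      IsLeast {W | S.IsCoinvariant W ∧ S.IsCyclic W} V := by
  obtain ⟨V, hfd, -, R, hR⟩ := hfc
  have hV := hR.dilation.starInvariant
  have hsoc : FiniteDimensional ℂ (S.socle V.toSubmodule) :=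
    Submodule.finiteDimensional_of_le (S.socle_le _)
  have hinv := S.starInvariant_socle V.toSubmodule
  refine ⟨⟨S.socle V.toSubmodule, Submodule.closed_of_finiteDimensional _⟩, hsoc,
    ⟨(S.isCoinvariant_iff _).2 hinv, (S.isCyclic_iff _ hinv.alg).2 ?_⟩, fun W hW => ?_⟩
  · exact socle_cyclic hS hco hV hR.minimal
  · have hWinv := (S.isCoinvariant_iff W).1 hW.1
    exact socle_le_of_cyclic hS hco W.isClosed hWinv ((S.isCyclic_iff W hWinv.alg).1 hW.2)

lemma isMinimalCyclicCoinvariant_iff_eq {S : CorrRep A E H} {V W : ClosedSubmodule ℂ H}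
    (hV : IsLeast {W | S.IsCoinvariant W ∧ S.IsCyclic W} V) :
    S.IsMinimalCyclicCoinvariant W ↔ W = V := by
  constructor
  · exact fun h => (h.minimal V (hV.2 ⟨h.coinvariant, h.cyclic⟩) hV.1.1 hV.1.2).symm
  · rintro rfl
    exact ⟨hV.1.1, hV.1.2, fun W hle hco hcy => le_antisymm hle (hV.2 ⟨hco, hcy⟩)⟩

end CorrRep

/-! ### Extending a unitary between compressions -/

/-- Total families with the same Gram matrix are carried into each other by a unitary. -/
lemma exists_linearIsometryEquiv_of_inner_eq {ι H K : Type*}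
    [NormedAddCommGroup H] [InnerProductSpace ℂ H] [CompleteSpace H]
    [NormedAddCommGroup K] [InnerProductSpace ℂ K] [CompleteSpace K]
    (f : ι → H) (g : ι → K) (hfg : ∀ i j, ⟪f i, f j⟫_ℂ = ⟪g i, g j⟫_ℂ)
    (hf : (Submodule.span ℂ (Set.range f)).topologicalClosure = ⊤)
    (hg : (Submodule.span ℂ (Set.range g)).topologicalClosure = ⊤) :
    ∃ U : H ≃ₗᵢ[ℂ] K, ∀ i, U (f i) = g i := by
  have dense : DenseRange (Finsupp.linearCombination ℂ f) := by
    rw [DenseRange, ← LinearMap.coe_range, Finsupp.range_linearCombination]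
    exact Submodule.dense_iff_topologicalClosure_eq_top.2 hf
  have dense' : DenseRange (Finsupp.linearCombination ℂ g) := by
    rw [DenseRange, ← LinearMap.coe_range, Finsupp.range_linearCombination]
    exact Submodule.dense_iff_topologicalClosure_eq_top.2 hg
  -- Equal Gram matrices give equal norms to linear combinations with the same coefficients, so
  -- matching them is isometric between dense subspaces.
  have hnorm : ∀ x : ι →₀ ℂ, ‖Finsupp.linearCombination ℂ g (LinearEquiv.refl ℂ (ι →₀ ℂ) x)‖
      = ‖Finsupp.linearCombination ℂ f x‖ := by
    intro x
    have h : ⟪Finsupp.linearCombination ℂ g x, Finsupp.linearCombination ℂ g x⟫_ℂ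
        = ⟪Finsupp.linearCombination ℂ f x, Finsupp.linearCombination ℂ f x⟫_ℂ := by
      simp only [Finsupp.linearCombination_apply, Finsupp.sum, sum_inner, inner_sum,
        inner_smul_left, inner_smul_right, hfg]
    rw [LinearEquiv.refl_apply, @norm_eq_sqrt_re_inner ℂ, @norm_eq_sqrt_re_inner ℂ H, h]
  refine ⟨(LinearEquiv.refl ℂ (ι →₀ ℂ)).extendOfIsometry _ _ dense dense' hnorm,
    fun i => ?_⟩
  simpa using LinearEquiv.extendOfIsometry_eq (LinearEquiv.refl ℂ (ι →₀ ℂ)) _ _ dense dense'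
    hnorm (Finsupp.single i 1)

/-- The image of a closed subspace under a unitary. -/
def ClosedSubmodule.mapUnitary {H K : Type*} [NormedAddCommGroup H] [InnerProductSpace ℂ H]
    [NormedAddCommGroup K] [InnerProductSpace ℂ K] (V : ClosedSubmodule ℂ H) (U : H ≃ₗᵢ[ℂ] K) :
    ClosedSubmodule ℂ K :=
  V.comap (U.symm.toContinuousLinearEquiv : K →L[ℂ] H)

namespace CorrRep

variable {A E H K : Type*} [CStarAlgebra A] [PartialOrder A] [StarOrderedRing A]
  [NormedAddCommGroup E] [NormedSpace ℂ E] [CompleteSpace E] [Module Aᵐᵒᵖ E]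
  [CStarCorrespondence A E]
  [NormedAddCommGroup H] [InnerProductSpace ℂ H] [CompleteSpace H]
  [NormedAddCommGroup K] [InnerProductSpace ℂ K] [CompleteSpace K]

section Extension

variable {S : CorrRep A E H} {T : CorrRep A E K} {V : ClosedSubmodule ℂ H}
  {W : ClosedSubmodule ℂ K}

/-- Invariance of `Vᗮ` under `S(ξ)` makes the part of `h` in `Vᗮ` invisible after projection. Hence
words project to products of compressions. -/
lemma StarInvariant.compress_map (hV : S.StarInvariant V.toSubmodule) (ξ : E) (h : H) :
    compress V (S.map ξ) (V.toSubmodule.orthogonalProjectionOnto h)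
      = V.toSubmodule.orthogonalProjectionOnto (S.map ξ h) := by
  have h1 := V.toSubmodule.sub_starProjection_mem_orthogonal h
  have h2 := hV.orthogonal.map ξ _ h1
  have h3 := Submodule.orthogonalProjectionOnto_eq_zero_iff.2 h2
  rw [map_sub, map_sub, sub_eq_zero] at h3
  exact h3.symm

lemma orthogonalProjectionOnto_word (hV : S.StarInvariant V.toSubmodule)
    (hW : T.StarInvariant W.toSubmodule) (u : V.toSubmodule ≃ₗᵢ[ℂ] W.toSubmodule)
    (hu : ∀ ξ v, u (compress V (S.map ξ) v) = compress W (T.map ξ) (u v))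
    (ξ : List E) (v : V.toSubmodule) :
    u (V.toSubmodule.orthogonalProjectionOnto ((ξ.map S.map).prod (v : H)))
      = W.toSubmodule.orthogonalProjectionOnto ((ξ.map T.map).prod (u v : K)) := by
  induction ξ with
  | nil => simp
  | cons x ξ ih =>
    simp only [List.map_cons, List.prod_cons, mul_apply_eq_comp]
    rw [← hV.compress_map, ← hW.compress_map, hu, ih]

/-- Leading letters cancel in pairs through `S(x)* S(y) = σ(⟨x, y⟩)`, until one word is empty; then
only the projection of the other onto `V` matters, and `u` intertwines it. -/
lemma inner_word_eq (hS : S.IsIsometric) (hT : T.IsIsometric) (hV : S.StarInvariant V.toSubmodule)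
    (hW : T.StarInvariant W.toSubmodule) (u : V.toSubmodule ≃ₗᵢ[ℂ] W.toSubmodule)
    (hu : ∀ ξ v, u (compress V (S.map ξ) v) = compress W (T.map ξ) (u v))
    (hua : ∀ a (v : V.toSubmodule), (u ⟨S.alg a v, hV.alg a v v.2⟩ : K) = T.alg a (u v))
    (ξ η : List E) (v w : V.toSubmodule) :
    ⟪(ξ.map S.map).prod (v : H), (η.map S.map).prod (w : H)⟫_ℂ
      = ⟪(ξ.map T.map).prod (u v : K), (η.map T.map).prod (u w : K)⟫_ℂ := by
  have base : ∀ (η : List E) (v w : V.toSubmodule),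
      ⟪(v : H), (η.map S.map).prod (w : H)⟫_ℂ
        = ⟪(u v : K), (η.map T.map).prod (u w : K)⟫_ℂ := by
    intro η v w
    rw [← Submodule.inner_orthogonalProjectionOnto_eq_of_mem_left v,
      ← Submodule.inner_orthogonalProjectionOnto_eq_of_mem_left (u v),
      ← orthogonalProjectionOnto_word hV hW u hu, LinearIsometryEquiv.inner_map_map]
  induction ξ generalizing η v w with
  | nil => simpa using base η v w
  | cons x ξ ih =>
    cases η with
    | nil =>
      rw [← inner_conj_symm, ← inner_conj_symm (((x :: ξ).map T.map).prod (u v : K))]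
      simpa using congrArg (starRingEnd ℂ) (base (x :: ξ) w v)
    | cons y η =>
      simp only [List.map_cons, List.prod_cons, mul_apply_eq_comp, hS.inner_map_map,
        hT.inner_map_map]
      -- The factor `σ(⟨x, y⟩)` is absorbed by the vector `w` if no letter remains, and otherwise by
      -- the next letter.
      cases η with
      | nil =>
        have := ih [] v ⟨S.alg (ip A x y) w, hV.alg _ w w.2⟩
        simpa [hua] using this
      | cons z η =>
        have := ih (leftAction (ip A x y) z :: η) v w
        simpa [alg_map_apply] using this

/-- A unitary intertwining compressions to cyclic coinvariant subspaces extends to a unitary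
equivalence. -/
lemma unitarilyEquivalent_of_compression (hS : S.IsIsometric) (hT : T.IsIsometric)
    (hV : S.IsCoinvariant V) (hW : T.IsCoinvariant W) (hVc : S.IsCyclic V) (hWc : T.IsCyclic W)
    (h : (S.compression V hV).UnitarilyEquivalent (T.compression W hW)) :
    S.UnitarilyEquivalent T := by
  obtain ⟨u, hu, hua⟩ := h
  have hV' := (S.isCoinvariant_iff V).1 hV
  have hW' := (T.isCoinvariant_iff W).1 hW
  rw [isCyclic_iff _ _ hV'.alg] at hVc
  rw [isCyclic_iff _ _ hW'.alg] at hWc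
  have hua' : ∀ a (v : V.toSubmodule), (u ⟨S.alg a v, hV'.alg a v v.2⟩ : K) = T.alg a (u v) := by
    intro a v
    rw [← coe_compress_alg hW]
    refine (congrArg (fun x => (u x : K)) ?_).trans (congrArg Subtype.val (hua a v))
    exact Subtype.ext (coe_compress_alg hV a v).symm
  let f : List E × V.toSubmodule → H := fun p => (p.1.map S.map).prod (p.2 : H)
  let g : List E × V.toSubmodule → K := fun p => (p.1.map T.map).prod (u p.2 : K)
  have hf : (Submodule.span ℂ (Set.range f)).topologicalClosure = ⊤ := by
    rw [← hVc, wordSpan]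
    congr 2
    ext x
    constructor
    · rintro ⟨⟨ξ, v⟩, rfl⟩; exact ⟨ξ, v, v.2, rfl⟩
    · rintro ⟨ξ, v, hv, rfl⟩; exact ⟨(ξ, ⟨v, hv⟩), rfl⟩
  have hg : (Submodule.span ℂ (Set.range g)).topologicalClosure = ⊤ := by
    rw [← hWc, wordSpan]
    congr 2
    ext x
    constructor
    · rintro ⟨⟨ξ, v⟩, rfl⟩; exact ⟨ξ, u v, (u v).2, rfl⟩
    · rintro ⟨ξ, w, hw, rfl⟩; exact ⟨(ξ, u.symm ⟨w, hw⟩), by simp [g]⟩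
  obtain ⟨U, hU⟩ := exists_linearIsometryEquiv_of_inner_eq f g
    (fun p q => inner_word_eq hS hT hV' hW' u hu hua' p.1 q.1 p.2 q.2) hf hg
  have ext_range : ∀ (X : H →L[ℂ] H) (Y : K →L[ℂ] K), (∀ p, U (X (f p)) = Y (g p)) →
      ∀ x, U (X x) = Y (U x) := by
    intro X Y hXY x
    have hd : Dense (Submodule.span ℂ (Set.range f) : Set H) :=
      Submodule.dense_iff_topologicalClosure_eq_top.2 hf
    have := ContinuousLinearMap.ext_on (f := (U.toContinuousLinearEquiv : H →L[ℂ] K) ∘L X)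
      (g := Y ∘L (U.toContinuousLinearEquiv : H →L[ℂ] K)) hd (by
        rintro _ ⟨p, rfl⟩
        exact (hXY p).trans (congrArg Y (hU p)).symm)
    exact congrArg (fun Z : H →L[ℂ] K => Z x) this
  refine ⟨U, fun ξ => ext_range _ _ ?_, fun a => ext_range _ _ ?_⟩
  · rintro ⟨η, v⟩
    have := hU (ξ :: η, v)
    simpa [f, g] using this
  · rintro ⟨η, v⟩
    cases η with
    | nil =>
      have := hU ([], ⟨S.alg a v, hV'.alg a v v.2⟩)
      simpa [f, g, hua'] using this
    | cons y η =>
      have := hU (leftAction a y :: η, v)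
      simpa [f, g, alg_map_apply] using this

end Extension

/-! ### Transport along a unitary equivalence -/

section Transport

variable {S : CorrRep A E H} {T : CorrRep A E K} {U : H ≃ₗᵢ[ℂ] K}

lemma isCoinvariant_mapUnitary (hU : ∀ ξ h, U (S.map ξ h) = T.map ξ (U h))
    (hUa : ∀ a h, U (S.alg a h) = T.alg a (U h)) {V : ClosedSubmodule ℂ H}
    (hV : S.IsCoinvariant V) : T.IsCoinvariant (V.mapUnitary U) := by
  rw [isCoinvariant_iff] at hV ⊢
  refine ⟨fun a w hw => ?_, fun ξ w hw => ?_⟩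
  · change U.symm _ ∈ V.toSubmodule
    have : U.symm (T.alg a w) = S.alg a (U.symm w) := by
      rw [U.symm_apply_eq, hUa, U.apply_symm_apply]
    rw [this]
    exact hV.alg a _ hw
  · change U.symm _ ∈ V.toSubmodule
    have : U.symm (star (T.map ξ) w) = star (S.map ξ) (U.symm w) := by
      refine ext_inner_right ℂ fun h => ?_
      rw [← U.inner_map_map, U.apply_symm_apply, ContinuousLinearMap.star_eq_adjoint,
        ContinuousLinearMap.star_eq_adjoint, ContinuousLinearMap.adjoint_inner_left,
        ContinuousLinearMap.adjoint_inner_left, ← U.inner_map_map (U.symm w), hU,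
        U.apply_symm_apply]
    rw [this]
    exact hV.map ξ _ hw

lemma isCyclic_mapUnitary (hU : ∀ ξ h, U (S.map ξ h) = T.map ξ (U h))
    (hUa : ∀ a h, U (S.alg a h) = T.alg a (U h)) {V : ClosedSubmodule ℂ H}
    (hV : S.IsCoinvariant V) (hc : S.IsCyclic V) : T.IsCyclic (V.mapUnitary U) := by
  have hV' := (S.isCoinvariant_iff V).1 hV
  have hW' := (T.isCoinvariant_iff _).1 (isCoinvariant_mapUnitary hU hUa hV)
  rw [isCyclic_iff _ _ hV'.alg] at hc
  rw [isCyclic_iff _ _ hW'.alg, eq_top_iff]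
  intro k _
  have hk : U.symm k ∈ (S.wordSpan V.toSubmodule).topologicalClosure := hc ▸ Submodule.mem_top
  have hmap : ∀ h ∈ S.wordSpan V.toSubmodule, U h ∈ T.wordSpan (V.mapUnitary U).toSubmodule := by
    intro h hh
    induction hh using Submodule.span_induction with
    | mem x hx =>
      obtain ⟨ξ, v, hv, rfl⟩ := hx
      refine Submodule.subset_span ⟨ξ, U v, ?_, ?_⟩
      · change U.symm (U v) ∈ V
        rwa [U.symm_apply_apply]
      · induction ξ with
        | nil => simp
        | cons x ξ ih => simp [hU, ih]
    | zero => simp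
    | add x y _ _ hx hy => rw [map_add]; exact add_mem hx hy
    | smul c x _ hx => rw [map_smul]; exact Submodule.smul_mem _ c hx
  have := map_mem_closure U.continuous hk hmap
  rwa [U.apply_symm_apply] at this

/-- A unitary equivalence restricts to the least cyclic coinvariant subspaces. -/
lemma UnitarilyEquivalent.compression {V : ClosedSubmodule ℂ H} {W : ClosedSubmodule ℂ K}
    (h : S.UnitarilyEquivalent T)
    (hV : IsLeast {V | S.IsCoinvariant V ∧ S.IsCyclic V} V)
    (hW : IsLeast {W | T.IsCoinvariant W ∧ T.IsCyclic W} W) :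
    (S.compression V hV.1.1).UnitarilyEquivalent (T.compression W hW.1.1) := by
  obtain ⟨U, hU, hUa⟩ := h
  have hU' : ∀ ξ k, U.symm (T.map ξ k) = S.map ξ (U.symm k) := fun ξ k => by
    rw [U.symm_apply_eq, hU, U.apply_symm_apply]
  have hUa' : ∀ a k, U.symm (T.alg a k) = S.alg a (U.symm k) := fun a k => by
    rw [U.symm_apply_eq, hUa, U.apply_symm_apply]
  have h1 : W ≤ V.mapUnitary U := hW.2 ⟨isCoinvariant_mapUnitary hU hUa hV.1.1,
    isCyclic_mapUnitary hU hUa hV.1.1 hV.1.2⟩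
  have h2 : V ≤ W.mapUnitary U.symm := hV.2 ⟨isCoinvariant_mapUnitary hU' hUa' hW.1.1,
    isCyclic_mapUnitary hU' hUa' hW.1.1 hW.1.2⟩
  -- Leastness used in both directions forces `U` to carry `V` onto `W`.
  have hmap : V.toSubmodule.map (U.toLinearEquiv : H →ₗ[ℂ] K) = W.toSubmodule := by
    ext k
    constructor
    · rintro ⟨v, hv, rfl⟩
      exact h2 hv
    · exact fun hk => ⟨U.symm k, h1 hk, U.apply_symm_apply k⟩
  let u : V.toSubmodule ≃ₗᵢ[ℂ] W.toSubmodule :=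
    { U.toLinearEquiv.ofSubmodules _ _ hmap with norm_map' := fun v => U.norm_map v }
  have hu : ∀ v, (u v : K) = U v := fun v => rfl
  refine ⟨u, fun ξ v => ?_, fun a v => ?_⟩
  -- Tested against vectors of the subspace, the projections disappear and the intertwining relation
  -- for `U` applies.
  · refine ext_inner_right ℂ fun w => ?_
    obtain ⟨w, rfl⟩ := u.surjective w
    rw [u.inner_map_map]
    change ⟪V.toSubmodule.orthogonalProjectionOnto (S.map ξ (v : H)), w⟫_ℂ
      = ⟪W.toSubmodule.orthogonalProjectionOnto (T.map ξ (u v : K)), u w⟫_ℂ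
    rw [Submodule.inner_orthogonalProjectionOnto_eq_of_mem_right,
      Submodule.inner_orthogonalProjectionOnto_eq_of_mem_right, hu, hu, ← hU, U.inner_map_map]
  · apply Subtype.ext
    change (u (compress V (S.alg a) v) : K) = (compress W (T.alg a) (u v) : K)
    rw [hu, coe_compress_alg hV.1.1, coe_compress_alg hW.1.1, hUa, hu]

end Transport

end CorrRep

theorem mainTheorem4
    {A E HS HT : Type*} [CStarAlgebra A] [PartialOrder A] [StarOrderedRing A]
    [NormedAddCommGroup E] [NormedSpace ℂ E] [CompleteSpace E] [Module Aᵐᵒᵖ E]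
    [CStarCorrespondence A E]
    [NormedAddCommGroup HS] [InnerProductSpace ℂ HS] [CompleteSpace HS]
    [NormedAddCommGroup HT] [InnerProductSpace ℂ HT] [CompleteSpace HT]
    (S : CorrRep A E HS) (T : CorrRep A E HT)
    (hS_iso : S.IsIsometric) (hS_fc : S.IsFinitelyCorrelated) (hS_co : S.IsFullyCoisometric)
    (hT_iso : T.IsIsometric) (hT_fc : T.IsFinitelyCorrelated) (hT_co : T.IsFullyCoisometric) :
    (∃! V : ClosedSubmodule ℂ HS, S.IsMinimalCyclicCoinvariant V) ∧
    (∃! V : ClosedSubmodule ℂ HT, T.IsMinimalCyclicCoinvariant V) ∧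
    ∀ (VS : ClosedSubmodule ℂ HS) (VT : ClosedSubmodule ℂ HT)
      (hVS : S.IsMinimalCyclicCoinvariant VS) (hVT : T.IsMinimalCyclicCoinvariant VT),
      FiniteDimensional ℂ VS.toSubmodule ∧ FiniteDimensional ℂ VT.toSubmodule ∧
      (S.UnitarilyEquivalent T ↔
        (S.compression VS hVS.coinvariant).UnitarilyEquivalent
          (T.compression VT hVT.coinvariant)) := by
  obtain ⟨V, hVfd, hV⟩ := hS_fc.exists_least hS_iso hS_co
  obtain ⟨W, hWfd, hW⟩ := hT_fc.exists_least hT_iso hT_co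
  refine ⟨⟨V, (CorrRep.isMinimalCyclicCoinvariant_iff_eq hV).2 rfl,
      fun _ => (CorrRep.isMinimalCyclicCoinvariant_iff_eq hV).1⟩,
    ⟨W, (CorrRep.isMinimalCyclicCoinvariant_iff_eq hW).2 rfl,
      fun _ => (CorrRep.isMinimalCyclicCoinvariant_iff_eq hW).1⟩, fun VS VT hVS hVT => ?_⟩
  obtain rfl := (CorrRep.isMinimalCyclicCoinvariant_iff_eq hV).1 hVS
  obtain rfl := (CorrRep.isMinimalCyclicCoinvariant_iff_eq hW).1 hVT
  exact ⟨hVfd, hWfd, fun h => h.compression hV hW, CorrRep.unitarilyEquivalent_of_compression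
    hS_iso hT_iso hVS.coinvariant hVT.coinvariant hVS.cyclic hVT.cyclic⟩
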